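/- Let $m,s,l,u$ be integers with $m\ge 1$ and $0<l\le u\le s$, and put $t=ms$. A deck has $m$ ranks with $s$ cards in each rank; it is well shuffled (all $t!$ orders equally likely) and the cards are drawn one at a time without replacement. Let $X^{(n)}=(X^{(n)}_1,\dots,X^{(n)}_m)$ be the numbers of cards of each rank among the first $n$ cards drawn. Define $$N_1=\inf\{n\ge ml:\ l\le X^{(n)}_j\le u \text{ for all } j\},\qquad N_2=\inf\{n\ge u+1:\ \max_j X^{(n)}_j=u+1\},\qquad N=\min(N_1,N_2),$$ where $\inf\emptyset=\infty$, and let $P[N=n,\text{band}]=P[N=N_1=n]$ and $n_{\max}=l+(m-1)u$. For $n\ge 0$ and non-negative integers $c_1,\dots,c_k$ with $n\le\sum_j c_j$, let $H_k(n;c_1,\dots,c_k)$ denote the multiple hypergeometric law, which gives a vector $x$ of non-negative integers with $\sum_j x_j=n$ the probability $\prod_j\binom{c_j}{x_j}\big/\binom{\sum_j c_j}{n}$. Then for every $n$ with $ml\le n\le n_{\max}$, $$P[N=n,\text{band}]=P[Y_{n-1}=l-1]\;P\big[X'\in\{l,\dots,u\}^{m-1}\big],$$ where $(Y_{n-1},\,n-1-Y_{n-1})\sim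 H_2(n-1;\,s-1,\,t-s)$ and $X'\sim H_{m-1}(n-l;\,s,\dots,s)$. Moreover, the sequence $p_n=P[N=n,\text{band}]$, $ml\le n\le n_{\max}$, is log-concave in $n$: it is non-negative, $p_{n+1}\,p_{n-1}\le p_n^2$ whenever $ml<n<n_{\max}$, and the set $\{n: ml\le n\le n_{\max},\ p_n>0\}$ consists of consecutive integers. -/

import Mathlib

namespace BandBump

/-- A sequence `p` on the index range `a, …, b` is (discrete) log-concave: it is non-negative,
`p (n+1) * p (n-1) ≤ p n ^ 2` at interior indices, and its support consists of consecutive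
integers. -/
def LogConcaveBetween (p : ℕ → ℝ) (a b : ℕ) : Prop :=
  (∀ n, a ≤ n → n ≤ b → 0 ≤ p n) ∧
  (∀ n, a < n → n < b → p (n + 1) * p (n - 1) ≤ p n ^ 2) ∧
  Set.OrdConnected {n : ℕ | a ≤ n ∧ n ≤ b ∧ 0 < p n}

/-- Point probability at `x` of the multiple hypergeometric law `H_k(n; c 0, …, c (k-1))`:
the tallies of the `k` types in a sample of size `n` drawn without replacement from a population
having `c j` members of type `j`. -/
noncomputable def multiHypergeom {k : ℕ} (c : Fin k → ℕ) (n : ℕ) (x : Fin k → ℕ) : ℝ :=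
  if ∑ j, x j = n then (∏ j, ((c j).choose (x j) : ℝ)) / ((∑ j, c j).choose n : ℝ) else 0

/-- Probability that `X ~ H_k(n; c)` lies in the rectangle `∏ j, {a j, …, b j}`. -/
noncomputable def rectProb {k : ℕ} (c : Fin k → ℕ) (n : ℕ) (a b : Fin k → ℕ) : ℝ :=
  ∑ x ∈ Fintype.piFinset (fun j => Finset.Icc (a j) (b j)), multiHypergeom c n x

/-- The orders in which the `m * s` cards can be drawn; a card is a pair (rank, copy). -/
abbrev Shuffle (m s : ℕ) : Type := Fin (m * s) ≃ Fin m × Fin s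

instance (m s : ℕ) : Nonempty (Shuffle m s) := ⟨finProdFinEquiv.symm⟩

/-- Probability of an event for a well-shuffled deck (all orders equally likely). -/
noncomputable def prob {m s : ℕ} (A : Set (Shuffle m s)) : ℝ :=
  ((PMF.uniformOfFintype (Shuffle m s)).toOuterMeasure A).toReal

/-- The tally of rank `j` after `n` cards have been drawn. -/
def tally {m s : ℕ} (σ : Shuffle m s) (n : ℕ) (j : Fin m) : ℕ :=
  (Finset.univ.filter (fun i : Fin (m * s) => i.val < n ∧ (σ i).1 = j)).card

/-- First time `n ≥ m * l` at which all tallies lie in `{l, …, u}` (`⊤` if there is none). -/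
noncomputable def bandTime {m s : ℕ} (l u : ℕ) (σ : Shuffle m s) : ℕ∞ :=
  sInf {k : ℕ∞ | ∃ n : ℕ, k = n ∧ m * l ≤ n ∧ n ≤ m * s ∧
    ∀ j, l ≤ tally σ n j ∧ tally σ n j ≤ u}

/-- First time `n ≥ u + 1` at which the largest tally equals `u + 1` (`⊤` if there is none). -/
noncomputable def bumpTime {m s : ℕ} (u : ℕ) (σ : Shuffle m s) : ℕ∞ :=
  sInf {k : ℕ∞ | ∃ n : ℕ, k = n ∧ u + 1 ≤ n ∧ n ≤ m * s ∧
    Finset.univ.sup (tally σ n) = u + 1}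

/-- The band or bump stopping time. -/
noncomputable def stopTime {m s : ℕ} (l u : ℕ) (σ : Shuffle m s) : ℕ∞ :=
  min (bandTime l u σ) (bumpTime u σ)

/-- `P[N = n, band]`: the game stops at draw `n`, with a band. -/
noncomputable def bandProb (m s l u n : ℕ) : ℝ :=
  prob {σ : Shuffle m s | stopTime l u σ = n ∧ bandTime l u σ = n}

end BandBump

/-! A bump cannot precede a band, since tallies only grow and none exceeds `u` at a band. A band
occurs at draw `n` exactly when that draw lifts the only rank still below `l` from tally `l - 1` to
`l`, the other tallies lying in `[l, u]`. The card drawn and the set of earlier cards form a uniform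
pair, so with `T = ∑_{l ≤ i ≤ u} C(s,i) X^i` counting gives `p_n = C(s-1, l-1) · [X^(n-l)] T^(m-1) /
C(ms-1, n-1)`. The product formula rearranges this (`bandProb_eq_mul`). The coefficient is positive
on the whole range, which settles the support.

For log-concavity put `k = n - l` and insert `C((m-1)s, k)`. The factor `C((m-1)s, k) / C(ms-1,
k+l-1)` is handled directly (`choose_div_choose_logConcave`). The factor `[X^k] T^(m-1) / C((m-1)s,
k)` is handled by Liggett's theorem (`UltraLogConcave.mul`): coefficients that are log-concave after
division by binomials stay so under multiplication of polynomials.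

Liggett's theorem is proved with Lorentzian forms. Homogenize the factors to binary forms in
disjoint variables, `f(x₀,x₁) g(x₂,x₃)`. Identifying `x₀ = x₂` and `x₁ = x₃` turns the normalized
coefficients of the product into mixed derivatives along `e₀ + e₂` and `e₁ + e₃`. Hessians of
coordinate derivatives satisfy reverse Cauchy–Schwarz because `f` and `g` have log-concave
normalized coefficients, and `IsLorentzian.add_of_derivatives` carries this to derivatives along the
sums. The argument needs positive coefficients, so the zeros of `T` are replaced by powers of `ε`,
and `ε → 0` at the end. -/

namespace BandBump

/-! ### Reverse Cauchy–Schwarz for sums of Hessians -/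

/-- A bilinear form satisfying the reverse Cauchy–Schwarz inequality against every vector of
positive square. -/
def IsLorentzian {V : Type*} [AddCommGroup V] [Module ℝ V] (F : LinearMap.BilinForm ℝ V) : Prop :=
  ∀ z w, 0 < F w w → F z z * F w w ≤ F z w ^ 2

section Forms

variable {V : Type*} [AddCommGroup V] [Module ℝ V]

theorem isLorentzian_zero : IsLorentzian (0 : LinearMap.BilinForm ℝ V) := by
  intro z w h
  simp at h

/-- It suffices to test the reverse Cauchy–Schwarz inequality against one vector. -/
theorem isLorentzian_of_basepoint (F : LinearMap.BilinForm ℝ V) (hF : ∀ z w, F z w = F w z) (e : V)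
    (he : 0 < F e e) (h : ∀ z, F z z * F e e ≤ F z e ^ 2) : IsLorentzian F := by
  intro z w hw
  have hr : 0 < F w e ^ 2 := lt_of_lt_of_le (mul_pos hw he) (h w)
  -- This combination is orthogonal to `e`, so its square is nonpositive; completing the square in
  -- the expansion gives the claim.
  have hu := h (F w e • z - F z e • w)
  have h0 : F (F w e • z - F z e • w) e = 0 := by
    simp only [map_sub, map_smul, LinearMap.sub_apply, LinearMap.smul_apply, smul_eq_mul]
    ring
  rw [h0] at hu
  have h1 : F (F w e • z - F z e • w) (F w e • z - F z e • w) ≤ 0 := by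
    by_contra hc
    push Not at hc
    nlinarith [mul_pos hc he]
  simp only [map_sub, map_smul, LinearMap.sub_apply, LinearMap.smul_apply, smul_eq_mul,
    hF w z] at h1
  have h2 : F w e ^ 2 * (F z z * F w w - F z w ^ 2) ≤ 0 := by
    nlinarith [mul_le_mul_of_nonneg_left h1 hw.le, sq_nonneg (F w e * F z w - F z e * F w w)]
  by_contra hc
  push Not at hc
  nlinarith [mul_pos hr (sub_pos.2 hc)]

/-- If `F = P + Q` with `P`, `Q` Lorentzian, where `P` and `Q` are the derivatives of a cubic form
along `A` and `B`, then `F` is Lorentzian. -/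
theorem IsLorentzian.add_of_derivatives {P Q : LinearMap.BilinForm ℝ V}
    (hPs : ∀ z w, P z w = P w z) (hQs : ∀ z w, Q z w = Q w z)
    (hP : IsLorentzian P) (hQ : IsLorentzian Q) (A B : V)
    (hPA : ∀ z, P z (A + B) = (P + Q) z A) (hQB : ∀ z, Q z (A + B) = (P + Q) z B)
    (ha : 0 ≤ (P + Q) A A) (hb : 0 < (P + Q) A B) (hc : 0 ≤ (P + Q) B B) :
    IsLorentzian (P + Q) := by
  have hFs : ∀ z w, (P + Q) z w = (P + Q) w z := fun z w => by simp [hPs z w, hQs z w]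
  have hsum : ∀ z, (P + Q) z z = P z z + Q z z := fun z => rfl
  generalize (P + Q : LinearMap.BilinForm ℝ V) = F at *
  obtain ⟨a, haa⟩ : ∃ a, a = F A A := ⟨_, rfl⟩
  obtain ⟨b, hbb⟩ : ∃ b, b = F A B := ⟨_, rfl⟩
  obtain ⟨c, hcc⟩ : ∃ c, c = F B B := ⟨_, rfl⟩
  have hBA : F B A = b := by rw [hFs, hbb]
  rw [← haa] at ha
  rw [← hbb] at hb
  rw [← hcc] at hc
  have hp : 0 < a + b := by linarith
  have hq : 0 < b + c := by linarith
  have hPe : P (A + B) (A + B) = a + b := by rw [hPA, map_add, LinearMap.add_apply, hBA, ← haa]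
  have hQe : Q (A + B) (A + B) = b + c := by
    rw [hQB, map_add, LinearMap.add_apply, ← hbb, ← hcc]
  have hFe : F (A + B) (A + B) = a + b + (b + c) := by rw [hsum, hPe, hQe]
  -- Add the inequalities for `P` and `Q` against `A + B`, where `P z (A + B) = F z A` and `Q z (A +
  -- B) = F z B`.
  have key : ∀ z, F z z * ((a + b) * (b + c)) ≤ F z A ^ 2 * (b + c) + F z B ^ 2 * (a + b) := by
    intro z
    have h1 := hP z (A + B) (by rw [hPe]; exact hp)
    have h2 := hQ z (A + B) (by rw [hQe]; exact hq)
    rw [hPe, hPA] at h1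
    rw [hQe, hQB] at h2
    rw [hsum]
    nlinarith
  obtain ⟨δ, hδ⟩ : ∃ δ, δ = a * c - b ^ 2 := ⟨_, rfl⟩
  -- `w` is `F`-orthogonal to `A + B`; testing `key` on it forces the Gram determinant `δ` of `A, B`
  -- to be nonpositive.
  obtain ⟨w, hw⟩ : ∃ w, w = (b + c) • A - (a + b) • B := ⟨_, rfl⟩
  have hwA : F w A = δ := by
    simp only [hw, map_sub, map_smul, LinearMap.sub_apply, LinearMap.smul_apply, smul_eq_mul, hBA,
      ← haa]
    rw [hδ]; ring
  have hwB : F w B = -δ := by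
    simp only [hw, map_sub, map_smul, LinearMap.sub_apply, LinearMap.smul_apply, smul_eq_mul,
      ← hbb, ← hcc]
    rw [hδ]; ring
  have hFw : ∀ z, F z w = (b + c) * F z A - (a + b) * F z B := fun z => by
    simp only [hw, map_sub, map_smul, smul_eq_mul]
  have hww : F w w = (a + b + (b + c)) * δ := by
    rw [hFw, hwA, hwB]; ring
  have hpq : 0 < (a + b) * (b + c) := mul_pos hp hq
  have hσ : 0 < a + b + (b + c) := by linarith
  have hδpq : δ < (a + b) * (b + c) := by rw [hδ]; nlinarith [mul_pos hb hp, mul_pos hb hq]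
  have hδneg : δ ≤ 0 := by
    have h1 := key w
    rw [hww, hwA, hwB] at h1
    by_contra hpos
    push Not at hpos
    have h2 : (a + b + (b + c)) * δ * ((a + b) * (b + c) - δ) ≤ 0 := by nlinarith
    nlinarith [mul_pos (mul_pos hσ hpos) (sub_pos.2 hδpq)]
  have hδlow : -((a + b) * (b + c)) ≤ δ := by
    rw [hδ]; nlinarith [mul_nonneg ha hc, mul_nonneg ha hb.le, mul_nonneg hb.le hc]
  refine isLorentzian_of_basepoint F hFs (A + B) (by rw [hFe]; exact hσ) fun z => ?_
  rw [hFe, map_add]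
  obtain ⟨y, hy⟩ : ∃ y, y = F z A := ⟨_, rfl⟩
  obtain ⟨x, hx⟩ : ∃ x, x = F z B := ⟨_, rfl⟩
  obtain ⟨p, hpe⟩ : ∃ p, p = a + b := ⟨_, rfl⟩
  obtain ⟨q, hqe⟩ : ∃ q, q = b + c := ⟨_, rfl⟩
  have hz := fun t : ℝ => key (z - t • w)
  simp only [map_sub, map_smul, LinearMap.sub_apply, LinearMap.smul_apply, smul_eq_mul, hFs w z,
    hFw z, hww, hwA, hwB] at hz
  simp only [← hpe, ← hqe, ← hy, ← hx] at *
  -- The optimal shift has `δ` in its denominator. This one avoids that: it gives the exact bound at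
  -- `δ = 0`, and otherwise leaves an error of the sign of `δ (3pq + δ)`, nonpositive because `-pq ≤
  -- δ ≤ 0`.
  have hz' := hz (-(q * y - p * x) / (2 * (p * q * (p + q))))
  obtain ⟨r, hr⟩ : ∃ r, r = (q * y - p * x) / (2 * (p * q * (p + q))) := ⟨_, rfl⟩
  have hκ : q * y - p * x = r * (2 * (p * q * (p + q))) := by
    rw [hr, div_mul_cancel₀]; positivity
  rw [neg_div, ← hr] at hz'
  have h3 : 0 ≤ r ^ 2 * ((-δ) * (3 * (p * q) + δ)) := by
    apply mul_nonneg (sq_nonneg _) (mul_nonneg (by linarith) (by linarith))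
  have h4 : (p + q) * (F z z * (p * q)) ≤ (p * q) * (y + x) ^ 2 := by
    linear_combination (p + q) * hz' + (p + q) ^ 2 * h3 +
      (-2 * r * (p + q) * p * q + 2 * r * (p + q) * δ + (q * y - p * x) +
        r * (2 * (p * q * (p + q)))) * hκ
  have : (p * q) * (F z z * (p + q)) ≤ (p * q) * (y + x) ^ 2 := by linarith
  exact le_of_mul_le_mul_left this hpq
end Forms

/-! ### Differential monomials in the coordinate directions and their sums -/

section Monomials

variable {R : Type*} [CommRing R]

/-- The monomials in `a, b, c, d, a + c, b + d`. -/
abbrev mon (v : Fin 4 → R) (i j k l p q : ℕ) : R :=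
  v 0 ^ i * v 1 ^ j * v 2 ^ k * v 3 ^ l * (v 0 + v 2) ^ p * (v 1 + v 3) ^ q

theorem mon_succ_left (v : Fin 4 → R) (i j k l p q : ℕ) :
    mon v i j k l (p + 1) q = mon v (i + 1) j k l p q + mon v i j (k + 1) l p q := by
  simp only [mon]; ring

theorem mon_succ_right (v : Fin 4 → R) (i j k l p q : ℕ) :
    mon v i j k l p (q + 1) = mon v i (j + 1) k l p q + mon v i j k (l + 1) p q := by
  simp only [mon]; ring

theorem mon_mul_mul (v : Fin 4 → R) (i j k l p q : ℕ) (a b : Fin 4) :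
    mon v i j k l p q * (v a * v b) =
      mon v (i + (Pi.single a 1 + Pi.single b 1 : Fin 4 → ℕ) 0)
        (j + (Pi.single a 1 + Pi.single b 1 : Fin 4 → ℕ) 1)
        (k + (Pi.single a 1 + Pi.single b 1 : Fin 4 → ℕ) 2)
        (l + (Pi.single a 1 + Pi.single b 1 : Fin 4 → ℕ) 3) p q := by
  fin_cases a <;> fin_cases b <;> simp [mon] <;> ring

end Monomials

/-! ### Hessians of a product of two binary forms -/

section ProductForm

variable {R : Type*} [CommRing R] [Algebra ℝ R]

/-- The bilinear form `(z, w) ↦ Φ (M ℓ(z) ℓ(w))`, where `ℓ(z) = z₀ a + z₁ b + z₂ c + z₃ d`. -/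
def derivForm (Φ : R →ₗ[ℝ] ℝ) (v : Fin 4 → R) (M : R) : LinearMap.BilinForm ℝ (Fin 4 → ℝ) :=
  ((LinearMap.mul ℝ R).compr₂ (Φ ∘ₗ LinearMap.mulLeft ℝ M)).compl₁₂
    (Fintype.linearCombination ℝ v) (Fintype.linearCombination ℝ v)

theorem derivForm_apply (Φ : R →ₗ[ℝ] ℝ) (v : Fin 4 → R) (M : R) (z w : Fin 4 → ℝ) :
    derivForm Φ v M z w = Φ (M * ((∑ i, z i • v i) * ∑ i, w i • v i)) := rfl

theorem derivForm_add (Φ : R →ₗ[ℝ] ℝ) (v : Fin 4 → R) (M M' : R) :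
    derivForm Φ v (M + M') = derivForm Φ v M + derivForm Φ v M' := by
  ext z w
  simp [derivForm, add_mul]

theorem derivForm_symm (Φ : R →ₗ[ℝ] ℝ) (v : Fin 4 → R) (M : R) (z w : Fin 4 → ℝ) :
    derivForm Φ v M z w = derivForm Φ v M w z := by
  rw [derivForm_apply, derivForm_apply, mul_comm (∑ i, z i • v i)]

theorem derivForm_single (Φ : R →ₗ[ℝ] ℝ) (v : Fin 4 → R) (M : R) (i j : Fin 4) :
    derivForm Φ v M (Pi.single i 1) (Pi.single j 1) = Φ (M * (v i * v j)) := by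
  simp [derivForm]

theorem derivForm_expand (Φ : R →ₗ[ℝ] ℝ) (v : Fin 4 → R) (M : R) (z w : Fin 4 → ℝ) :
    derivForm Φ v M z w = ∑ i, ∑ j, z i * w j * Φ (M * (v i * v j)) := by
  rw [derivForm_apply, Finset.sum_mul_sum]
  simp only [Finset.mul_sum, map_sum]
  refine Finset.sum_congr rfl fun i _ => Finset.sum_congr rfl fun j _ => ?_
  rw [smul_mul_smul_comm, mul_smul_comm, map_smul, smul_eq_mul]

/-- The value at the polynomial `a^i b^j c^k d^l` of the functional representing the product of
two binary forms, with normalized coefficients `α` and `β`, in disjoint variables. -/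
structure IsProductFunctional (Φ : R →ₗ[ℝ] ℝ) (v : Fin 4 → R) (n m : ℕ) (α β : ℕ → ℝ) : Prop where
  eval : ∀ i j k l, Φ (v 0 ^ i * v 1 ^ j * v 2 ^ k * v 3 ^ l) =
    if i + j = n ∧ k + l = m then α i * β k else 0
  pos_left : ∀ i ≤ n, 0 < α i
  pos_right : ∀ i ≤ m, 0 < β i
  logConcave_left : ∀ i, i + 2 ≤ n → α i * α (i + 2) ≤ α (i + 1) ^ 2
  logConcave_right : ∀ i, i + 2 ≤ m → β i * β (i + 2) ≤ β (i + 1) ^ 2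

namespace IsProductFunctional

variable {Φ : R →ₗ[ℝ] ℝ} {v : Fin 4 → R} {n m : ℕ} {α β : ℕ → ℝ}

theorem mon_eq_zero (h : IsProductFunctional Φ v n m α β) (i j k l p q : ℕ)
    (hd : n < i + j ∨ m < k + l) : Φ (mon v i j k l p q) = 0 := by
  induction q generalizing i j k l with
  | zero =>
    induction p generalizing i j k l with
    | zero =>
      simp only [mon, pow_zero, mul_one, h.eval]
      rw [if_neg (by omega)]
    | succ p ih =>
      rw [mon_succ_left, map_add, ih _ _ _ _ (by omega), ih _ _ _ _ (by omega), add_zero]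
  | succ q ih =>
    rw [mon_succ_right, map_add, ih _ _ _ _ (by omega), ih _ _ _ _ (by omega), add_zero]

theorem mon_pos (h : IsProductFunctional Φ v n m α β) (i j k l p q : ℕ)
    (hd : i + j + k + l + p + q = n + m) (h1 : i + j ≤ n) (h2 : k + l ≤ m) :
    0 < Φ (mon v i j k l p q) := by
  induction q generalizing i j k l with
  | zero =>
    induction p generalizing i j k l with
    | zero =>
      simp only [mon, pow_zero, mul_one, h.eval]
      rw [if_pos (by omega)]
      exact mul_pos (h.pos_left _ (by omega)) (h.pos_right _ (by omega))
    | succ p ih =>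
      rw [mon_succ_left, map_add]
      rcases lt_or_ge (i + j) n with h3 | h3
      · have := ih (i + 1) j k l (by omega) (by omega) (by omega)
        rcases lt_or_ge (k + l) m with h4 | h4
        · have := ih i j (k + 1) l (by omega) (by omega) (by omega)
          linarith
        · rw [h.mon_eq_zero i j (k + 1) l _ _ (by omega)]
          linarith
      · rw [h.mon_eq_zero (i + 1) j k l _ _ (by omega), zero_add]
        exact ih i j (k + 1) l (by omega) (by omega) (by omega)
  | succ q ih =>
    rw [mon_succ_right, map_add]
    rcases lt_or_ge (i + j) n with h3 | h3
    · have := ih i (j + 1) k l (by omega) (by omega) (by omega)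
      rcases lt_or_ge (k + l) m with h4 | h4
      · have := ih i j k (l + 1) (by omega) (by omega) (by omega)
        linarith
      · rw [h.mon_eq_zero i j k (l + 1) _ _ (by omega)]
        linarith
    · rw [h.mon_eq_zero i (j + 1) k l _ _ (by omega), zero_add]
      exact ih i j k (l + 1) (by omega) (by omega) (by omega)

theorem mon_nonneg (h : IsProductFunctional Φ v n m α β) (i j k l p q : ℕ)
    (hd : i + j + k + l + p + q = n + m) : 0 ≤ Φ (mon v i j k l p q) := by
  by_cases h1 : i + j ≤ n ∧ k + l ≤ m
  · exact (h.mon_pos i j k l p q hd h1.1 h1.2).le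
  · exact (h.mon_eq_zero i j k l p q (by omega)).ge

theorem derivForm_mon_eq_zero (h : IsProductFunctional Φ v n m α β) (i j k l p q : ℕ)
    (hd : n < i + j ∨ m < k + l) : derivForm Φ v (mon v i j k l p q) = 0 := by
  ext a b
  simp only [LinearMap.comp_apply, LinearMap.coe_single, derivForm_single, LinearMap.zero_apply,
    mon_mul_mul]
  exact h.mon_eq_zero _ _ _ _ _ _ (by omega)

theorem isLorentzian_base (h : IsProductFunctional Φ v n m α β) (i j k l : ℕ)
    (hd : i + j + k + l + 2 = n + m) : IsLorentzian (derivForm Φ v (mon v i j k l 0 0)) := by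
  by_cases hz : n < i + j ∨ m < k + l
  · rw [h.derivForm_mon_eq_zero _ _ _ _ _ _ hz]
    exact isLorentzian_zero
  obtain ⟨r, hr⟩ : ∃ r, n = i + j + r := ⟨n - (i + j), by omega⟩
  obtain ⟨s, hs⟩ : ∃ s, m = k + l + s := ⟨m - (k + l), by omega⟩
  have e : ∀ a b, Φ (mon v i j k l 0 0 * (v a * v b)) =
      if ((Pi.single a 1 + Pi.single b 1 : Fin 4 → ℕ) 0 +
          (Pi.single a 1 + Pi.single b 1 : Fin 4 → ℕ) 1 = r) ∧
        ((Pi.single a 1 + Pi.single b 1 : Fin 4 → ℕ) 2 +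
          (Pi.single a 1 + Pi.single b 1 : Fin 4 → ℕ) 3 = s) then
        α (i + (Pi.single a 1 + Pi.single b 1 : Fin 4 → ℕ) 0) *
          β (k + (Pi.single a 1 + Pi.single b 1 : Fin 4 → ℕ) 2) else 0 := by
    intro a b
    rw [mon_mul_mul]
    simp only [mon, pow_zero, mul_one, h.eval]
    refine if_congr ?_ rfl rfl
    omega
  have hp := h.pos_left
  have hq := h.pos_right
  -- `r` and `s` are the degrees left in the two factors. If one factor keeps degree 2,
  -- log-concavity of its coefficients is the determinant condition; if each keeps degree 1, the
  -- quadratic form is a product of two linear forms.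
  obtain ⟨rfl, rfl⟩ | ⟨rfl, rfl⟩ | ⟨rfl, rfl⟩ :
      (r = 2 ∧ s = 0) ∨ (r = 1 ∧ s = 1) ∨ (r = 0 ∧ s = 2) := by omega
  · apply isLorentzian_of_basepoint _ (derivForm_symm _ _ _) (Pi.single 0 1)
    · rw [derivForm_single, e]
      simpa using mul_pos (hp (i + 2) (by omega)) (hq k (by omega))
    · intro z
      simp [derivForm_expand, e, Fin.sum_univ_four, Pi.single_apply]
      nlinarith [mul_le_mul_of_nonneg_left (h.logConcave_left i (by omega))
        (mul_nonneg (sq_nonneg (z 1)) (sq_nonneg (β k)))]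
  · apply isLorentzian_of_basepoint _ (derivForm_symm _ _ _) (Pi.single 0 1 + Pi.single 2 1)
    · simp only [map_add, LinearMap.add_apply, derivForm_single, e]
      have := mul_pos (hp (i + 1) (by omega)) (hq (k + 1) (by omega))
      simp
      positivity
    · intro z
      simp [derivForm_expand, e, Fin.sum_univ_four, Pi.single_apply]
      nlinarith [sq_nonneg (β (k + 1) * (z 0 * α (i + 1) + z 1 * α i) -
        α (i + 1) * (z 2 * β (k + 1) + z 3 * β k))]
  · apply isLorentzian_of_basepoint _ (derivForm_symm _ _ _) (Pi.single 2 1)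
    · rw [derivForm_single, e]
      simpa using mul_pos (hp i (by omega)) (hq (k + 2) (by omega))
    · intro z
      simp [derivForm_expand, e, Fin.sum_univ_four, Pi.single_apply]
      nlinarith [mul_le_mul_of_nonneg_left (h.logConcave_right k (by omega))
        (mul_nonneg (sq_nonneg (z 3)) (sq_nonneg (α i)))]

theorem isLorentzian (h : IsProductFunctional Φ v n m α β) (i j k l p q : ℕ)
    (hd : i + j + k + l + p + q + 2 = n + m) :
    IsLorentzian (derivForm Φ v (mon v i j k l p q)) := by
  induction q generalizing i j k l with
  | zero =>
    induction p generalizing i j k l with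
    | zero => exact h.isLorentzian_base i j k l (by omega)
    | succ p ih =>
      rw [mon_succ_left, derivForm_add]
      -- If a factor has no degree left, one summand vanishes. Otherwise both survive, which gives
      -- the strict positivity of `F A B` needed to add them.
      by_cases h1 : n < i + 1 + j
      · rw [h.derivForm_mon_eq_zero _ _ _ _ _ _ (Or.inl h1), zero_add]
        exact ih _ _ _ _ (by omega)
      by_cases h2 : m < k + 1 + l
      · rw [h.derivForm_mon_eq_zero i j _ _ _ _ (Or.inr h2), add_zero]
        exact ih _ _ _ _ (by omega)
      apply IsLorentzian.add_of_derivatives (derivForm_symm _ _ _) (derivForm_symm _ _ _)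
        (ih _ _ _ _ (by omega)) (ih _ _ _ _ (by omega)) (Pi.single 0 1) (Pi.single 2 1)
      · intro z
        rw [← derivForm_add]
        simp only [derivForm, map_add, mon]
        simp
        rw [← map_add]
        congr 1
        ring
      · intro z
        rw [← derivForm_add]
        simp only [derivForm, map_add, mon]
        simp
        rw [← map_add]
        congr 1
        ring
      · rw [← derivForm_add, ← mon_succ_left, derivForm_single]
        convert h.mon_nonneg (i + 2) j k l (p + 1) 0 (by omega) using 2
        simp only [mon]; ring
      · rw [← derivForm_add, ← mon_succ_left, derivForm_single]
        convert h.mon_pos (i + 1) j (k + 1) l (p + 1) 0 (by omega) (by omega) (by omega) using 2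
        simp only [mon]; ring
      · rw [← derivForm_add, ← mon_succ_left, derivForm_single]
        convert h.mon_nonneg i j (k + 2) l (p + 1) 0 (by omega) using 2
        simp only [mon]; ring
  | succ q ih =>
    rw [mon_succ_right, derivForm_add]
    by_cases h1 : n < i + (j + 1)
    · rw [h.derivForm_mon_eq_zero _ _ _ _ _ _ (Or.inl h1), zero_add]
      exact ih _ _ _ _ (by omega)
    by_cases h2 : m < k + (l + 1)
    · rw [h.derivForm_mon_eq_zero i j _ _ _ _ (Or.inr h2), add_zero]
      exact ih _ _ _ _ (by omega)
    apply IsLorentzian.add_of_derivatives (derivForm_symm _ _ _) (derivForm_symm _ _ _)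
      (ih _ _ _ _ (by omega)) (ih _ _ _ _ (by omega)) (Pi.single 1 1) (Pi.single 3 1)
    · intro z
      rw [← derivForm_add]
      simp only [derivForm, map_add, mon]
      simp
      rw [← map_add]
      congr 1
      ring
    · intro z
      rw [← derivForm_add]
      simp only [derivForm, map_add, mon]
      simp
      rw [← map_add]
      congr 1
      ring
    · rw [← derivForm_add, ← mon_succ_right, derivForm_single]
      convert h.mon_nonneg i (j + 2) k l p (q + 1) (by omega) using 2
      simp only [mon]; ring
    · rw [← derivForm_add, ← mon_succ_right, derivForm_single]
      convert h.mon_pos i (j + 1) k (l + 1) p (q + 1) (by omega) (by omega) (by omega) using 2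
      simp only [mon]; ring
    · rw [← derivForm_add, ← mon_succ_right, derivForm_single]
      convert h.mon_nonneg i j k (l + 2) p (q + 1) (by omega) using 2
      simp only [mon]; ring

/-- Reverse Cauchy–Schwarz for the Hessian of the `(p, q)` derivative, tested on the directions `e₁
+ e₃` and `e₀ + e₂`. -/
theorem mon_logConcave (h : IsProductFunctional Φ v n m α β) (p q : ℕ) (hd : p + q + 2 = n + m) :
    Φ (mon v 0 0 0 0 p (q + 2)) * Φ (mon v 0 0 0 0 (p + 2) q) ≤
      Φ (mon v 0 0 0 0 (p + 1) (q + 1)) ^ 2 := by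
  have key := h.isLorentzian 0 0 0 0 p q (by omega) (Pi.single 1 1 + Pi.single 3 1)
    (Pi.single 0 1 + Pi.single 2 1)
  have e : ∀ a b c d : Fin 4, derivForm Φ v (mon v 0 0 0 0 p q)
      (Pi.single a 1 + Pi.single b 1) (Pi.single c 1 + Pi.single d 1) =
      Φ (mon v 0 0 0 0 p q * ((v a + v b) * (v c + v d))) := by
    intro a b c d
    simp only [map_add, LinearMap.add_apply, derivForm_single]
    simp only [← map_add]
    congr 1; ring
  simp only [e] at key
  have e1 : mon v 0 0 0 0 p q * ((v 1 + v 3) * (v 1 + v 3)) = mon v 0 0 0 0 p (q + 2) := by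
    simp only [mon]; ring
  have e2 : mon v 0 0 0 0 p q * ((v 0 + v 2) * (v 0 + v 2)) = mon v 0 0 0 0 (p + 2) q := by
    simp only [mon]; ring
  have e3 : mon v 0 0 0 0 p q * ((v 1 + v 3) * (v 0 + v 2)) = mon v 0 0 0 0 (p + 1) (q + 1) := by
    simp only [mon]; ring
  rw [e1, e2, e3] at key
  exact key (h.mon_pos _ _ _ _ _ _ (by omega) (by omega) (by omega))

end IsProductFunctional

end ProductForm

/-! ### Liggett's theorem -/

/-- `p = ∑ i ≤ n, C(n, i) α i X ^ i` with `α` positive and log-concave. -/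
structure UltraLogConcave (n : ℕ) (p : Polynomial ℝ) : Prop where
  pos : ∀ i ≤ n, 0 < p.coeff i
  coeff_eq_zero : ∀ i, n < i → p.coeff i = 0
  logConcave : ∀ i, i + 2 ≤ n → p.coeff i / n.choose i * (p.coeff (i + 2) / n.choose (i + 2)) ≤
    (p.coeff (i + 1) / n.choose (i + 1)) ^ 2

/-- The functional representing the product of two binary forms of degrees `n` and `m`. -/
noncomputable def productFunctional (n m : ℕ) (α β : ℕ → ℝ) : MvPolynomial (Fin 4) ℝ →ₗ[ℝ] ℝ :=
  (MvPolynomial.basisMonomials (Fin 4) ℝ).constr ℝ fun d =>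
    if d 0 + d 1 = n ∧ d 2 + d 3 = m then α (d 0) * β (d 2) else 0

theorem productFunctional_apply (n m : ℕ) (α β : ℕ → ℝ) (i j k l : ℕ) :
    productFunctional n m α β (MvPolynomial.X 0 ^ i * MvPolynomial.X 1 ^ j * MvPolynomial.X 2 ^ k *
      MvPolynomial.X 3 ^ l) = if i + j = n ∧ k + l = m then α i * β k else 0 := by
  have h : (MvPolynomial.X 0 ^ i * MvPolynomial.X 1 ^ j * MvPolynomial.X 2 ^ k *
      MvPolynomial.X 3 ^ l : MvPolynomial (Fin 4) ℝ) = MvPolynomial.basisMonomials (Fin 4) ℝ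
        (Finsupp.single 0 i + Finsupp.single 1 j + Finsupp.single 2 k + Finsupp.single 3 l) := by
    simp [MvPolynomial.X_pow_eq_monomial, MvPolynomial.monomial_mul]
  rw [h, productFunctional, Module.Basis.constr_basis]
  simp

/-- Both sides are the multinomial coefficient `(i+j+k+l)! / (i! j! k! l!)`. -/
theorem choose_mul_choose_mul_choose (i j k l : ℕ) :
    ((i + k).choose i * (j + l).choose j * (i + j + (k + l)).choose (i + k) : ℝ) =
      (i + j + (k + l)).choose (i + j) * ((i + j).choose i * (k + l).choose k) := by
  have e : i + j + (k + l) = (i + k) + (j + l) := by ring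
  rw [Nat.cast_add_choose ℝ (a := i + j) (b := k + l), e, Nat.cast_add_choose, Nat.cast_add_choose,
    Nat.cast_add_choose, Nat.cast_add_choose, Nat.cast_add_choose]
  have := fun n => Nat.factorial_ne_zero n
  field_simp

/-- Identifies the derivative along the summed directions with a convolution: expand both binomial
powers, and the degree conditions leave at most one `y` for each `x`. -/
theorem productFunctional_mon (n m : ℕ) (α β : ℕ → ℝ) (p q : ℕ) (hpq : p + q = n + m) :
    productFunctional n m α β (mon MvPolynomial.X 0 0 0 0 p q) * (n + m).choose p =
      (n + m).choose n *
        ∑ x ∈ Finset.HasAntidiagonal.antidiagonal p, (n.choose x.1 * α x.1) * (m.choose x.2 * β x.2) := by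
  have h : (mon MvPolynomial.X 0 0 0 0 p q : MvPolynomial (Fin 4) ℝ) =
      ∑ x ∈ Finset.HasAntidiagonal.antidiagonal p, ∑ y ∈ Finset.HasAntidiagonal.antidiagonal q,
        ((p.choose x.1 * q.choose y.1 : ℕ) : ℝ) • (MvPolynomial.X 0 ^ x.1 * MvPolynomial.X 1 ^ y.1 *
          MvPolynomial.X 2 ^ x.2 * MvPolynomial.X 3 ^ y.2) := by
    simp only [mon, pow_zero, one_mul]
    rw [(Commute.all _ _).add_pow', (Commute.all _ _).add_pow', Finset.sum_mul_sum]
    refine Finset.sum_congr rfl fun x _ => Finset.sum_congr rfl fun y _ => ?_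
    rw [Nat.cast_smul_eq_nsmul]
    simp only [nsmul_eq_mul, Nat.cast_mul]
    ring
  rw [h, map_sum, Finset.sum_mul, Finset.mul_sum]
  refine Finset.sum_congr rfl fun x hx => ?_
  rw [Finset.HasAntidiagonal.mem_antidiagonal] at hx
  simp only [map_sum, map_smul, productFunctional_apply, smul_eq_mul]
  by_cases h1 : x.1 ≤ n ∧ x.2 ≤ m
  · rw [Finset.sum_eq_single (n - x.1, m - x.2)]
    · rw [if_pos (by dsimp only; omega)]
      obtain ⟨j, hj⟩ : ∃ j, n = x.1 + j := ⟨n - x.1, by omega⟩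
      obtain ⟨l, hl⟩ : ∃ l, m = x.2 + l := ⟨m - x.2, by omega⟩
      have e := choose_mul_choose_mul_choose x.1 j x.2 l
      have hq : q = j + l := by omega
      have e1 : n - x.1 = j := by omega
      dsimp only
      rw [e1, ← hx, hq, hj, hl]
      push_cast
      linear_combination α x.1 * β x.2 * e
    · intro y _ hne
      rw [if_neg, mul_zero]
      rintro ⟨h2, h3⟩
      exact hne (Prod.ext (by dsimp only; omega) (by dsimp only; omega))
    · intro hn
      exact absurd (Finset.HasAntidiagonal.mem_antidiagonal.2 (by dsimp only; omega)) hn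
  · rw [Finset.sum_eq_zero, zero_mul]
    · rcases not_and_or.1 h1 with h2 | h2
      · rw [Nat.choose_eq_zero_of_lt (not_le.1 h2)]; simp
      · rw [Nat.choose_eq_zero_of_lt (not_le.1 h2)]; simp
    · intro y _
      rw [if_neg (by omega), mul_zero]

theorem UltraLogConcave.isProductFunctional {n m : ℕ} {f g : Polynomial ℝ}
    (hf : UltraLogConcave n f) (hg : UltraLogConcave m g) :
    IsProductFunctional (productFunctional n m (fun i => f.coeff i / n.choose i)
      fun i => g.coeff i / m.choose i) MvPolynomial.X n m (fun i => f.coeff i / n.choose i)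
      fun i => g.coeff i / m.choose i where
  eval := productFunctional_apply _ _ _ _
  pos_left i hi := div_pos (hf.pos i hi) (Nat.cast_pos.2 (Nat.choose_pos hi))
  pos_right i hi := div_pos (hg.pos i hi) (Nat.cast_pos.2 (Nat.choose_pos hi))
  logConcave_left := hf.logConcave
  logConcave_right := hg.logConcave

theorem UltraLogConcave.choose_mul_div {n : ℕ} {f : Polynomial ℝ} (hf : UltraLogConcave n f)
    (i : ℕ) : n.choose i * (f.coeff i / n.choose i) = f.coeff i := by
  rcases le_or_gt i n with h | h
  · rw [mul_div_cancel₀]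
    exact Nat.cast_ne_zero.2 (Nat.choose_pos h).ne'
  · rw [Nat.choose_eq_zero_of_lt h, hf.coeff_eq_zero i h]; simp

/-- Liggett's theorem: ultra-log-concavity is preserved by convolution. -/
theorem UltraLogConcave.mul {n m : ℕ} {f g : Polynomial ℝ} (hf : UltraLogConcave n f)
    (hg : UltraLogConcave m g) : UltraLogConcave (n + m) (f * g) := by
  have hΦ := hf.isProductFunctional hg
  have hC : (0 : ℝ) < (n + m).choose n := Nat.cast_pos.2 (Nat.choose_pos (by omega))
  have key : ∀ p q, p + q = n + m → (f * g).coeff p / (n + m).choose p =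
      productFunctional n m (fun i => f.coeff i / n.choose i) (fun i => g.coeff i / m.choose i)
        (mon MvPolynomial.X 0 0 0 0 p q) / (n + m).choose n := by
    intro p q hpq
    have hp : (0 : ℝ) < (n + m).choose p := Nat.cast_pos.2 (Nat.choose_pos (by omega))
    have h := productFunctional_mon n m (fun i => f.coeff i / n.choose i)
      (fun i => g.coeff i / m.choose i) p q hpq
    simp only [hf.choose_mul_div, hg.choose_mul_div] at h
    rw [Polynomial.coeff_mul, div_eq_div_iff hp.ne' hC.ne', h, mul_comm]
  refine ⟨fun p hp => ?_, fun p hp => ?_, fun p hp => ?_⟩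
  · have hp' : (0 : ℝ) < (n + m).choose p := Nat.cast_pos.2 (Nat.choose_pos (by omega))
    have h1 := key p (n + m - p) (by omega)
    have h2 := hΦ.mon_pos 0 0 0 0 p (n + m - p) (by omega) (by omega) (by omega)
    have h3 := div_pos h2 hC
    rw [← h1] at h3
    exact (div_pos_iff_of_pos_right hp').1 h3
  · rw [Polynomial.coeff_mul]
    refine Finset.sum_eq_zero fun x hx => ?_
    rw [Finset.HasAntidiagonal.mem_antidiagonal] at hx
    by_cases h : n < x.1
    · rw [hf.coeff_eq_zero _ h, zero_mul]
    · rw [hg.coeff_eq_zero x.2 (by omega), mul_zero]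
  · rw [key p (n + m - p - 2 + 2) (by omega), key (p + 1) (n + m - p - 2 + 1) (by omega),
      key (p + 2) (n + m - p - 2) (by omega), div_mul_div_comm, div_pow, ← sq]
    exact div_le_div_of_nonneg_right (hΦ.mon_logConcave p (n + m - p - 2) (by omega)) (sq_nonneg _)

theorem UltraLogConcave.pow {n : ℕ} {f : Polynomial ℝ} (hf : UltraLogConcave n f) (r : ℕ) :
    UltraLogConcave (r * n) (f ^ r) := by
  induction r with
  | zero =>
    refine ⟨fun i hi => ?_, fun i hi => ?_, fun i hi => by omega⟩
    · have : i = 0 := by omega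
      simp [this]
    · rw [pow_zero, Polynomial.coeff_one, if_neg (by omega)]
  | succ r ih =>
    rw [pow_succ, Nat.add_mul, one_mul]
    exact ih.mul hf

/-! ### Powers of a truncated binomial -/

open Polynomial in
/-- The terms of degrees `l, …, u` of `(1 + X) ^ s`. -/
noncomputable def truncBinomial (s l u : ℕ) : ℝ[X] :=
  ∑ i ∈ Finset.Icc l u, monomial i (s.choose i : ℝ)

open Polynomial in
/-- A deformation of `truncBinomial s l u`, with the parameter as the inner variable. -/
noncomputable def smoothBinomial (s l u : ℕ) : ℝ[X][X] :=
  ∑ i ∈ Finset.range (s + 1), monomial i ((s.choose i : ℝ[X]) * X ^ ((l - i) ^ 2 + (i - u) ^ 2))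

theorem coeff_map_smoothBinomial (s l u : ℕ) (ε : ℝ) (i : ℕ) :
    ((smoothBinomial s l u).map (Polynomial.evalRingHom ε)).coeff i =
      s.choose i * ε ^ ((l - i) ^ 2 + (i - u) ^ 2) := by
  rw [Polynomial.coeff_map, smoothBinomial, Polynomial.finsetSum_coeff]
  simp only [Polynomial.coeff_monomial, Finset.sum_ite_eq', Finset.mem_range]
  split_ifs with h
  · simp
  · rw [Nat.choose_eq_zero_of_lt (by omega)]; simp

/-- By truncated subtraction the exponent of `ε` vanishes exactly on `[l, u]`, and `0 ^ 0 = 1`. -/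
theorem map_smoothBinomial_zero (s l u : ℕ) :
    (smoothBinomial s l u).map (Polynomial.evalRingHom 0) = truncBinomial s l u := by
  ext i
  rw [coeff_map_smoothBinomial, truncBinomial, Polynomial.finsetSum_coeff]
  simp only [Polynomial.coeff_monomial, Finset.sum_ite_eq', Finset.mem_Icc]
  split_ifs with h
  · rw [show l - i = 0 by omega, show i - u = 0 by omega]; simp
  · rw [zero_pow, mul_zero]
    intro h0
    have h1 : (l - i) ^ 2 = 0 := by omega
    have h2 : (i - u) ^ 2 = 0 := by omega
    rw [pow_eq_zero_iff two_ne_zero] at h1 h2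
    omega

/-- Convexity of the exponent makes `i ↦ ε ^ exponent` log-concave for `0 < ε ≤ 1`. -/
theorem smoothing_exponent_convex (l u i : ℕ) :
    2 * ((l - (i + 1)) ^ 2 + (i + 1 - u) ^ 2) ≤
      (l - i) ^ 2 + (i - u) ^ 2 + ((l - (i + 2)) ^ 2 + (i + 2 - u) ^ 2) := by
  have h1 : 2 * (l - (i + 1)) ^ 2 ≤ (l - i) ^ 2 + (l - (i + 2)) ^ 2 := by
    rcases le_or_gt l (i + 1) with h | h
    · rw [Nat.sub_eq_zero_of_le h]; simp
    · obtain ⟨d, rfl⟩ : ∃ d, l = i + 2 + d := ⟨l - (i + 2), by omega⟩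
      rw [show i + 2 + d - (i + 1) = d + 1 by omega, show i + 2 + d - i = d + 2 by omega,
        show i + 2 + d - (i + 2) = d by omega]
      nlinarith
  have h2 : 2 * (i + 1 - u) ^ 2 ≤ (i - u) ^ 2 + (i + 2 - u) ^ 2 := by
    rcases le_or_gt (i + 1) u with h | h
    · rw [Nat.sub_eq_zero_of_le h]; simp
    · obtain ⟨d, rfl⟩ : ∃ d, i = u + d := ⟨i - u, by omega⟩
      rw [show u + d + 1 - u = d + 1 by omega, show u + d - u = d by omega,
        show u + d + 2 - u = d + 2 by omega]
      nlinarith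
  omega

theorem ultraLogConcave_smoothBinomial (s l u : ℕ) {ε : ℝ} (h0 : 0 < ε) (h1 : ε ≤ 1) :
    UltraLogConcave s ((smoothBinomial s l u).map (Polynomial.evalRingHom ε)) := by
  have hC : ∀ i ≤ s, (0 : ℝ) < s.choose i := fun i hi => Nat.cast_pos.2 (Nat.choose_pos hi)
  refine ⟨fun i hi => ?_, fun i hi => ?_, fun i hi => ?_⟩
  · rw [coeff_map_smoothBinomial]
    exact mul_pos (hC i hi) (pow_pos h0 _)
  · rw [coeff_map_smoothBinomial, Nat.choose_eq_zero_of_lt hi]; simp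
  · simp only [coeff_map_smoothBinomial]
    rw [mul_div_cancel_left₀ _ (hC i (by omega)).ne',
      mul_div_cancel_left₀ _ (hC (i + 2) (by omega)).ne',
      mul_div_cancel_left₀ _ (hC (i + 1) (by omega)).ne', ← pow_add, ← pow_mul]
    apply pow_le_pow_of_le_one h0.le h1
    rw [mul_comm]
    exact smoothing_exponent_convex l u i

/-- Normalized coefficients of powers of a truncated binomial are log-concave. -/
theorem truncBinomial_pow_logConcave (s l u r k : ℕ) (hk : k + 2 ≤ r * s) :
    (truncBinomial s l u ^ r).coeff k / (r * s).choose k *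
        ((truncBinomial s l u ^ r).coeff (k + 2) / (r * s).choose (k + 2)) ≤
      ((truncBinomial s l u ^ r).coeff (k + 1) / (r * s).choose (k + 1)) ^ 2 := by
  have hc : ∀ i, ∀ ε : ℝ, (((smoothBinomial s l u).map (Polynomial.evalRingHom ε)) ^ r).coeff i =
      ((smoothBinomial s l u ^ r).coeff i).eval ε := by
    intro i ε
    rw [← Polynomial.map_pow, Polynomial.coeff_map, Polynomial.coe_evalRingHom]
  rw [← map_smoothBinomial_zero]
  simp only [hc]
  have hcont : ∀ i, Filter.Tendsto
      (fun ε : ℝ => ((smoothBinomial s l u ^ r).coeff i).eval ε / (r * s).choose i)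
      (nhdsWithin 0 (Set.Ioi 0))
      (nhds (((smoothBinomial s l u ^ r).coeff i).eval 0 / (r * s).choose i)) := fun i =>
    (((Polynomial.continuous _).div_const _).tendsto 0).mono_left nhdsWithin_le_nhds
  -- Each coefficient of the power is a polynomial in `ε`, so the non-strict inequality survives `ε
  -- → 0⁺`.
  refine le_of_tendsto_of_tendsto ((hcont k).mul (hcont (k + 2))) ((hcont (k + 1)).pow 2) ?_
  filter_upwards [Ioc_mem_nhdsGT (zero_lt_one (α := ℝ))] with ε hε
  have := ((ultraLogConcave_smoothBinomial s l u hε.1 hε.2).pow r).logConcave k hk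
  simpa only [hc] using this

theorem coeff_truncBinomial (s l u i : ℕ) :
    (truncBinomial s l u).coeff i = if i ∈ Finset.Icc l u then (s.choose i : ℝ) else 0 := by
  rw [truncBinomial, Polynomial.finsetSum_coeff]
  simp only [Polynomial.coeff_monomial, Finset.sum_ite_eq']

theorem truncBinomial_pow_coeff_nonneg (s l u r k : ℕ) :
    0 ≤ (truncBinomial s l u ^ r).coeff k := by
  induction r generalizing k with
  | zero => rw [pow_zero, Polynomial.coeff_one]; positivity
  | succ r ih =>
    rw [pow_succ, Polynomial.coeff_mul]
    refine Finset.sum_nonneg fun x _ => mul_nonneg (ih _) ?_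
    rw [coeff_truncBinomial]; positivity

theorem truncBinomial_pow_coeff_pos {s l u : ℕ} (hlu : l ≤ u) (hus : u ≤ s) (r k : ℕ)
    (h1 : r * l ≤ k) (h2 : k ≤ r * u) : 0 < (truncBinomial s l u ^ r).coeff k := by
  induction r generalizing k with
  | zero => simp at h2; simp [h2]
  | succ r ih =>
    rw [Nat.succ_mul] at h1 h2
    have hlu' : r * l ≤ r * u := Nat.mul_le_mul_left r hlu
    obtain ⟨i, hi1, hi2, hi3, hi4, hi5⟩ :
        ∃ i, l ≤ i ∧ i ≤ u ∧ i ≤ k ∧ r * l ≤ k - i ∧ k - i ≤ r * u :=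
      -- The least last part that leaves at most `r * u` for the other `r` factors.
      ⟨max l (k - r * u), by omega⟩
    rw [pow_succ, Polynomial.coeff_mul]
    refine Finset.sum_pos' (fun x _ => mul_nonneg (truncBinomial_pow_coeff_nonneg _ _ _ _ _) ?_)
      ⟨(k - i, i), Finset.HasAntidiagonal.mem_antidiagonal.2 (by dsimp only; omega),
        mul_pos (ih _ hi4 hi5) ?_⟩
    · rw [coeff_truncBinomial]; positivity
    · rw [coeff_truncBinomial, if_pos (Finset.mem_Icc.2 ⟨hi1, hi2⟩)]
      exact Nat.cast_pos.2 (Nat.choose_pos (hi2.trans hus))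

/-! ### Quotients of binomial coefficients -/

theorem choose_mul_choose_add_two (k b : ℕ) :
    ((k + b + 2).choose k * (k + b + 2).choose (k + 2) * ((b + 2) * (k + 2)) : ℝ) =
      (k + b + 2).choose (k + 1) ^ 2 * ((b + 1) * (k + 1)) := by
  have h : ∀ i j n : ℕ, i + j = n → (n.choose i : ℝ) = n.factorial / (i.factorial * j.factorial) :=
    fun i j n hn => hn ▸ Nat.cast_add_choose ℝ
  rw [h k (b + 2) _ (by ring), h (k + 2) b _ (by ring), h (k + 1) (b + 1) _ (by ring)]
  have hf := fun n => Nat.factorial_ne_zero n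
  simp only [Nat.factorial_succ k, Nat.factorial_succ (k + 1), Nat.factorial_succ b,
    Nat.factorial_succ (b + 1), Nat.cast_mul, Nat.cast_add, Nat.cast_one]
  have e1 := hf k
  have e2 := hf b
  field_simp
  ring

/-- `C(N, k) / C(N + a + d, k + a)` is log-concave in `k`. -/
theorem choose_div_choose_logConcave (k b a d : ℕ) :
    ((k + b + 2).choose k / (k + a + (b + d) + 2).choose (k + a) *
      ((k + b + 2).choose (k + 2) / (k + a + (b + d) + 2).choose (k + a + 2)) : ℝ) ≤
      ((k + b + 2).choose (k + 1) / (k + a + (b + d) + 2).choose (k + a + 1)) ^ 2 := by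
  have h1 := choose_mul_choose_add_two k b
  have h2 := choose_mul_choose_add_two (k + a) (b + d)
  have hp : ∀ i j : ℕ, i ≤ j → (0 : ℝ) < j.choose i := fun i j h => Nat.cast_pos.2 (Nat.choose_pos h)
  have p1 := hp (k + 1) (k + b + 2) (by omega)
  have p2 := hp (k + a) (k + a + (b + d) + 2) (by omega)
  have p3 := hp (k + a + 1) (k + a + (b + d) + 2) (by omega)
  have p4 := hp (k + a + 2) (k + a + (b + d) + 2) (by omega)
  rw [div_mul_div_comm, div_pow, div_le_div_iff₀ (mul_pos p2 p4) (pow_pos p3 2)]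
  push_cast at h2
  have e1 : ((k + b + 2).choose k * (k + b + 2).choose (k + 2) : ℝ) =
      (k + b + 2).choose (k + 1) ^ 2 * (((b + 1) * (k + 1)) / ((b + 2) * (k + 2))) := by
    field_simp; linear_combination h1
  have e2 : ((k + a + (b + d) + 2).choose (k + a) * (k + a + (b + d) + 2).choose (k + a + 2) : ℝ) =
      (k + a + (b + d) + 2).choose (k + a + 1) ^ 2 *
        (((b + d + 1) * (k + a + 1)) / ((b + d + 2) * (k + a + 2))) := by
    field_simp; linear_combination h2
  rw [e1, e2]
  -- Both sides are ratios `C_k C_{k+2} / C_{k+1}²`, products of terms `x / (x + 1)`, which increase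
  -- with `x`.
  have e3 : (((b + 1) * (k + 1)) / ((b + 2) * (k + 2)) : ℝ) ≤
      ((b + d + 1) * (k + a + 1)) / ((b + d + 2) * (k + a + 2)) := by
    rw [← div_mul_div_comm, ← div_mul_div_comm]
    have hb : (0 : ℝ) ≤ b := b.cast_nonneg
    have hd : (0 : ℝ) ≤ d := d.cast_nonneg
    have hk : (0 : ℝ) ≤ k := k.cast_nonneg
    have ha : (0 : ℝ) ≤ a := a.cast_nonneg
    apply mul_le_mul _ _ (by positivity) (by positivity)
    · rw [div_le_div_iff₀ (by positivity) (by positivity)]; nlinarith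
    · rw [div_le_div_iff₀ (by positivity) (by positivity)]; nlinarith
  have := mul_le_mul_of_nonneg_left e3 (mul_pos (pow_pos p1 2) (pow_pos p3 2)).le
  linarith

/-- Multiplies the two log-concave factors, with `a = l - 1` and `d = s - l`, so that `C(rs, k)`
cancels. For `r = m - 1` the new top index is `ms - 1`. -/
theorem truncBinomial_div_choose_logConcave {s l u : ℕ} (hl : 0 < l) (hls : l ≤ s)
    (r k : ℕ) (hk : k + 2 ≤ r * s) :
    (truncBinomial s l u ^ r).coeff k / (r * s + s - 1).choose (k + l - 1) *
        ((truncBinomial s l u ^ r).coeff (k + 2) / (r * s + s - 1).choose (k + l + 1)) ≤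
      ((truncBinomial s l u ^ r).coeff (k + 1) / (r * s + s - 1).choose (k + l)) ^ 2 := by
  have h1 := truncBinomial_pow_logConcave s l u r k hk
  have h2 := choose_div_choose_logConcave k (r * s - k - 2) (l - 1) (s - l)
  rw [show k + (r * s - k - 2) + 2 = r * s by omega,
    show k + (l - 1) + (r * s - k - 2 + (s - l)) + 2 = r * s + s - 1 by omega,
    show k + (l - 1) + 2 = k + l + 1 by omega, show k + (l - 1) + 1 = k + l by omega,
    show k + (l - 1) = k + l - 1 by omega] at h2
  have h3 := mul_le_mul h1 h2 (by positivity) (sq_nonneg _)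
  have hC : ∀ i ≤ r * s, ((r * s).choose i : ℝ) ≠ 0 := fun i hi =>
    Nat.cast_ne_zero.2 (Nat.choose_pos hi).ne'
  have e : ∀ c x y : ℝ, c ≠ 0 → x / c * (c / y) = x / y := fun c x y hc => by field_simp
  rw [mul_mul_mul_comm, ← mul_pow, e _ _ _ (hC k (by omega)), e _ _ _ (hC (k + 2) hk),
    e _ _ _ (hC (k + 1) (by omega))] at h3
  exact h3

/-! ### Next card and earlier cards as a uniform pair -/

section UniformPairs

variable {α β : Type*} [Fintype α] [Fintype β] [DecidableEq α] [DecidableEq β]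

/-- Permutations act transitively on such pairs: glue bijections between the classes `{c}`, `S` and
the rest, which have matching sizes. -/
theorem exists_equiv_map_eq {c c' : β} {S S' : Finset β} (hc : c ∉ S) (hc' : c' ∉ S')
    (h : S.card = S'.card) : ∃ e : β ≃ β, e c = c' ∧ S.map e.toEmbedding = S' := by
  let f : β → Finset β → β → Fin 3 := fun c S x => if x = c then 0 else if x ∈ S then 1 else 2
  have hf : ∀ c S, c ∉ S → ∀ k, Fintype.card {x // f c S x = k} =
      if k = 0 then 1 else if k = 1 then S.card else Fintype.card β - (S.card + 1) := by
    intro c S hc k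
    rw [Fintype.card_subtype]
    obtain rfl | rfl | rfl : k = 0 ∨ k = 1 ∨ k = 2 := by fin_cases k <;> simp
    · rw [show (Finset.univ.filter fun x => f c S x = (0 : Fin 3)) = {c} from ?_]
      · simp
      · ext x; simp [f]; grind
    · rw [show (Finset.univ.filter fun x => f c S x = (1 : Fin 3)) = S from ?_]
      · simp
      · ext x; simp [f]; grind
    · rw [show (Finset.univ.filter fun x => f c S x = (2 : Fin 3)) = (insert c S)ᶜ from ?_]
      · rw [Finset.card_compl, Finset.card_insert_of_notMem hc]; simp
      · ext x; simp [f]; grind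
  have e : ∀ k, Nonempty ({x // f c S x = k} ≃ {x // f c' S' x = k}) := fun k =>
    ⟨Fintype.equivOfCardEq (by rw [hf c S hc, hf c' S' hc', h])⟩
  let τ := Equiv.ofFiberEquiv fun k => (e k).some
  have hτ : ∀ x, f c' S' (τ x) = f c S x := fun x => Equiv.ofFiberEquiv_map _ x
  refine ⟨τ, ?_, ?_⟩
  · have := hτ c
    simp only [f] at this
    grind
  · ext x
    have := hτ (τ.symm x)
    simp only [f, Equiv.apply_symm_apply] at this
    rw [Finset.mem_map_equiv]
    grind

/-- For a uniform bijection `σ`, the pair `(σ a, σ(I))` with `a ∉ I` is uniform. -/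
theorem exists_card_equiv_eq_mul (a : α) (I : Finset α) (ha : a ∉ I) :
    ∃ K : ℕ, ∀ (E : β → Finset β → Prop) [∀ c, DecidablePred (E c)],
      (Finset.univ.filter fun σ : α ≃ β => E (σ a) (I.map σ.toEmbedding)).card =
        (∑ c, (((Finset.univ.erase c).powersetCard I.card).filter (E c)).card) * K := by
  let F : (_ : β) × Finset β → ℕ := fun p =>
    (Finset.univ.filter fun σ : α ≃ β => (⟨σ a, I.map σ.toEmbedding⟩ : (_ : β) × Finset β) = p).card
  have hF : ∀ p q : (_ : β) × Finset β, p.1 ∉ p.2 → q.1 ∉ q.2 → p.2.card = q.2.card →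
      F p = F q := by
    intro p q hp hq h
    obtain ⟨e, h1, h2⟩ := exists_equiv_map_eq hp hq h
    -- Composition with `e` carries the fibre over `p` to the fibre over `q`, so all fibres have one
    -- size `K`.
    refine Finset.card_bij (fun σ _ => σ.trans e) ?_ ?_ ?_
    · intro σ hσ
      simp only [Finset.mem_filter, Finset.mem_univ, true_and] at hσ ⊢
      subst hσ
      dsimp only at h1 h2
      rw [← Sigma.eta q, ← h1, ← h2, Finset.map_map]
      rfl
    · intro σ _ σ' _ h
      ext x
      have := Equiv.congr_fun h x
      simpa using this
    · intro σ hσ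
      simp only [Finset.mem_filter, Finset.mem_univ, true_and] at hσ
      refine ⟨σ.trans e.symm, ?_, ?_⟩
      · simp only [Finset.mem_filter, Finset.mem_univ, true_and]
        subst hσ
        dsimp only at h1 h2
        refine Sigma.ext (by simp [← h1]) (heq_of_eq ?_)
        apply Finset.map_injective e.toEmbedding
        rw [h2, Finset.map_map]
        congr 1
        ext x
        simp
      · ext x; simp
  obtain ⟨K, hK⟩ : ∃ K, ∀ p : (_ : β) × Finset β, p.1 ∉ p.2 → p.2.card = I.card → F p = K := by
    by_cases h : ∃ p : (_ : β) × Finset β, p.1 ∉ p.2 ∧ p.2.card = I.card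
    · obtain ⟨q, h1, h2⟩ := h
      exact ⟨F q, fun p hp hp' => hF p q hp h1 (hp'.trans h2.symm)⟩
    · exact ⟨0, fun p hp hp' => absurd ⟨p, hp, hp'⟩ h⟩
  refine ⟨K, fun E _ => ?_⟩
  rw [← Finset.card_sigma]
  rw [Finset.card_eq_sum_card_fiberwise
    (f := fun σ : α ≃ β => (⟨σ a, I.map σ.toEmbedding⟩ : (_ : β) × Finset β))
    (t := Finset.univ.sigma fun c => ((Finset.univ.erase c).powersetCard I.card).filter (E c))]
  · rw [Finset.sum_const_nat (m := K)]
    intro p hp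
    simp only [Finset.mem_sigma, Finset.mem_univ, true_and, Finset.mem_filter,
      Finset.mem_powersetCard, Finset.subset_erase] at hp
    rw [← hK p hp.1.1.2 hp.1.2, Finset.filter_filter]
    congr 1
    ext σ
    simp only [Finset.mem_filter, Finset.mem_univ, true_and, and_iff_right_iff_imp]
    rintro rfl
    exact hp.2
  · intro σ hσ
    simp only [Finset.coe_filter, Finset.mem_univ, true_and, Set.mem_ofPred_eq] at hσ
    simp only [Finset.coe_sigma, Set.mem_sigma_iff, Finset.coe_univ, Set.mem_univ, true_and,
      Finset.mem_coe, Finset.mem_filter, Finset.mem_powersetCard, Finset.subset_erase,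
      Finset.card_map, and_true]
    exact ⟨⟨Finset.subset_univ _, by simpa using ha⟩, hσ⟩

end UniformPairs

/-! ### Counting hands by generating functions -/

section Hands

variable {m s : ℕ}

/-- The cards of rank `i` in a set `S` of cards. -/
def ofRank (S : Finset (Fin m × Fin s)) (i : Fin m) : Finset (Fin s) :=
  Finset.univ.filter fun x => (i, x) ∈ S

theorem mem_ofRank {S : Finset (Fin m × Fin s)} {i : Fin m} {x : Fin s} :
    x ∈ ofRank S i ↔ (i, x) ∈ S := by simp [ofRank]

theorem sum_card_ofRank (S : Finset (Fin m × Fin s)) : ∑ i, (ofRank S i).card = S.card := by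
  simp only [ofRank, Finset.card_filter]
  rw [← Fintype.sum_prod_type' fun i x => if (i, x) ∈ S then 1 else 0]
  simp

/-- `S` holds `l - 1` cards of rank `j`, and between `l` and `u` cards of each other rank. -/
def AlmostBand (l u : ℕ) (j : Fin m) (S : Finset (Fin m × Fin s)) : Prop :=
  ∀ i, if i = j then (ofRank S i).card = l - 1 else (ofRank S i).card ∈ Finset.Icc l u

instance (l u : ℕ) (j : Fin m) : DecidablePred (AlmostBand (s := s) l u j) :=
  fun _ => inferInstanceAs (Decidable (∀ _, _))

theorem sum_X_pow_card_eq_truncBinomial (s l u : ℕ) :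
    ∑ T ∈ Finset.univ.filter (fun T : Finset (Fin s) => T.card ∈ Finset.Icc l u),
      (Polynomial.X : Polynomial ℝ) ^ T.card = truncBinomial s l u := by
  rw [truncBinomial, ← Finset.sum_fiberwise_of_maps_to (g := Finset.card) (t := Finset.Icc l u)
    (fun T hT => (Finset.mem_filter.1 hT).2)]
  refine Finset.sum_congr rfl fun k hk => ?_
  rw [Finset.filter_filter, Finset.sum_congr rfl (g := fun _ => Polynomial.X ^ k)
    (fun T hT => by rw [(Finset.mem_filter.1 hT).2.2]), Finset.sum_const]
  have : (Finset.univ.filter fun T : Finset (Fin s) => T.card ∈ Finset.Icc l u ∧ T.card = k) =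
      Finset.univ.powersetCard k := by
    ext T
    simp only [Finset.mem_filter, Finset.mem_univ, true_and, Finset.mem_powersetCard_univ,
      and_iff_right_iff_imp]
    rintro rfl
    exact hk
  rw [this, Finset.card_powersetCard, Finset.card_univ, Fintype.card_fin,
    ← Polynomial.C_mul_X_pow_eq_monomial, nsmul_eq_mul]
  simp

/-- Hands split into independent choices per rank. The rank of `c` contributes `C(s-1, l-1)
X^(l-1)`, since `c` is excluded, and every other rank contributes `truncBinomial s l u`. -/
theorem card_almostBand (l u k : ℕ) (c : Fin m × Fin s) (hk : l - 1 ≤ k) :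
    ((((Finset.univ.erase c).powersetCard k).filter (AlmostBand l u c.1)).card : ℝ) =
      (s - 1).choose (l - 1) * (truncBinomial s l u ^ (m - 1)).coeff (k - (l - 1)) := by
  let t : Fin m → Finset (Finset (Fin s)) := fun i => if i = c.1 then
    (Finset.univ.erase c.2).powersetCard (l - 1) else
      Finset.univ.filter fun T => T.card ∈ Finset.Icc l u
  have h1 : (((Finset.univ.erase c).powersetCard k).filter (AlmostBand l u c.1)).card =
      ((Fintype.piFinset t).filter fun T => ∑ i, (T i).card = k).card := by
    refine Finset.card_nbij' ofRank
      (fun T => Finset.univ.filter fun p : Fin m × Fin s => p.2 ∈ T p.1) ?_ ?_ ?_ ?_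
    · intro S hS
      simp only [Finset.coe_filter, Finset.mem_powersetCard, Finset.subset_erase,
        Set.mem_ofPred_eq] at hS
      obtain ⟨⟨⟨-, hc⟩, hcard⟩, hS⟩ := hS
      simp only [Finset.coe_filter, Set.mem_ofPred_eq, Fintype.mem_piFinset, sum_card_ofRank]
      refine ⟨fun i => ?_, hcard⟩
      have := hS i
      simp only [t]
      split_ifs at this ⊢ with h
      · subst h
        simp only [Finset.mem_powersetCard, Finset.subset_erase, Finset.subset_univ, true_and,
          mem_ofRank]
        exact ⟨hc, this⟩
      · simpa using this
    · intro T hT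
      simp only [Finset.coe_filter, Set.mem_ofPred_eq, Fintype.mem_piFinset] at hT
      obtain ⟨hT, hsum⟩ := hT
      have e : ofRank (Finset.univ.filter fun p : Fin m × Fin s => p.2 ∈ T p.1) = T := by
        ext i x; simp [mem_ofRank]
      simp only [Finset.coe_filter, Finset.mem_powersetCard, Finset.subset_erase,
        Set.mem_ofPred_eq]
      rw [← sum_card_ofRank, AlmostBand, e]
      refine ⟨⟨⟨Finset.subset_univ _, ?_⟩, hsum⟩, fun i => ?_⟩
      · have := hT c.1
        simp only [t, if_true, Finset.mem_powersetCard, Finset.subset_erase] at this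
        simpa using this.1.2
      · have := hT i
        simp only [t] at this
        split_ifs at this ⊢ with h
        · exact (Finset.mem_powersetCard.1 this).2
        · simpa using this
    · intro S _
      ext p; simp [mem_ofRank]
    · intro T _
      ext i x; simp [mem_ofRank]
  have h2 : ((((Fintype.piFinset t).filter fun T => ∑ i, (T i).card = k).card : ℕ) : ℝ) =
      (∏ i, ∑ T ∈ t i, (Polynomial.X : Polynomial ℝ) ^ T.card).coeff k := by
    rw [Finset.prod_univ_sum, Polynomial.finsetSum_coeff, Finset.card_filter]
    push_cast
    refine Finset.sum_congr rfl fun T _ => ?_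
    rw [Finset.prod_pow_eq_pow_sum, Polynomial.coeff_X_pow]
    simp only [eq_comm]
  have h3 : ∏ i, ∑ T ∈ t i, (Polynomial.X : Polynomial ℝ) ^ T.card =
      Polynomial.C ((s - 1).choose (l - 1) : ℝ) *
        (truncBinomial s l u ^ (m - 1) * Polynomial.X ^ (l - 1)) := by
    rw [← Finset.mul_prod_erase _ _ (Finset.mem_univ c.1), Finset.prod_congr rfl
      (g := fun _ => truncBinomial s l u) (fun i hi => by
        simp only [t, if_neg (Finset.ne_of_mem_erase hi), sum_X_pow_card_eq_truncBinomial]),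
      Finset.prod_const, Finset.card_erase_of_mem (Finset.mem_univ _), Finset.card_univ,
      Fintype.card_fin]
    simp only [t, if_true]
    rw [Finset.sum_congr rfl (g := fun _ => Polynomial.X ^ (l - 1))
      (fun T hT => by rw [(Finset.mem_powersetCard.1 hT).2]), Finset.sum_const,
      Finset.card_powersetCard, Finset.card_erase_of_mem (Finset.mem_univ _), Finset.card_univ,
      Fintype.card_fin, nsmul_eq_mul]
    simp only [map_natCast]
    ring
  rw [h1, h2, h3, Polynomial.coeff_C_mul, Polynomial.coeff_mul_X_pow', if_pos hk]

end Hands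

/-! ### Tallies and stopping times -/

theorem sInf_natCast_eq_iff (p : ℕ → Prop) (n : ℕ) :
    sInf {k : ℕ∞ | ∃ n : ℕ, k = n ∧ p n} = n ↔ p n ∧ ∀ k < n, ¬ p k := by
  constructor
  · intro h
    have hne : {k : ℕ∞ | ∃ n : ℕ, k = n ∧ p n}.Nonempty := by
      rw [Set.nonempty_iff_ne_empty]
      intro h0
      rw [h0, sInf_empty] at h
      exact ENat.top_ne_natCast n h
    obtain ⟨j, hj, hpj⟩ := csInf_mem hne
    rw [h] at hj
    refine ⟨Nat.cast_injective hj ▸ hpj, fun k hk hpk => ?_⟩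
    have : (n : ℕ∞) ≤ k := h ▸ sInf_le ⟨k, rfl, hpk⟩
    exact absurd (Nat.cast_le.1 this) (not_le.2 hk)
  · rintro ⟨h1, h2⟩
    refine le_antisymm (sInf_le (Set.mem_ofPred.2 ⟨n, rfl, h1⟩)) (le_sInf ?_)
    rintro _ ⟨k, rfl, hk⟩
    exact Nat.cast_le.2 (not_lt.1 fun h => h2 k h hk)

variable {m s : ℕ}

theorem tally_mono (σ : Shuffle m s) (j : Fin m) {a b : ℕ} (h : a ≤ b) :
    tally σ a j ≤ tally σ b j :=
  Finset.card_le_card fun i hi => by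
    simp only [Finset.mem_filter, Finset.mem_univ, true_and] at hi ⊢
    exact ⟨hi.1.trans_le h, hi.2⟩

/-- The positions of the first `n` draws. -/
def draws (m s n : ℕ) : Finset (Fin (m * s)) := Finset.univ.filter fun i => i.val < n

theorem card_draws {n : ℕ} (hn : n ≤ m * s) : (draws m s n).card = n := by
  rw [draws, Fin.card_filter_val_lt, min_eq_right hn]

theorem tally_eq_card_ofRank (σ : Shuffle m s) (n : ℕ) (j : Fin m) :
    tally σ n j = (ofRank ((draws m s n).map σ.toEmbedding) j).card := by
  refine Finset.card_bij (fun i _ => (σ i).2) ?_ ?_ ?_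
  · intro i hi
    simp only [Finset.mem_filter, Finset.mem_univ, true_and] at hi
    rw [mem_ofRank, Finset.mem_map_equiv, ← hi.2]
    simpa [draws] using hi.1
  · intro i hi i' hi' h
    simp only [Finset.mem_filter, Finset.mem_univ, true_and] at hi hi'
    exact σ.injective (Prod.ext (hi.2.trans hi'.2.symm) h)
  · intro x hx
    rw [mem_ofRank, Finset.mem_map_equiv] at hx
    refine ⟨σ.symm (j, x), ?_, by simp⟩
    simpa [draws] using hx

theorem sum_tally (σ : Shuffle m s) {n : ℕ} (hn : n ≤ m * s) : ∑ j, tally σ n j = n := by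
  simp only [tally_eq_card_ofRank, sum_card_ofRank, Finset.card_map, card_draws hn]

theorem tally_succ (σ : Shuffle m s) (n : ℕ) (hn : n < m * s) (j : Fin m) :
    tally σ (n + 1) j = tally σ n j + if j = (σ ⟨n, hn⟩).1 then 1 else 0 := by
  simp only [tally]
  split_ifs with h
  · rw [← Finset.card_insert_of_notMem (a := ⟨n, hn⟩) (by simp)]
    congr 1
    ext i
    simp only [Finset.mem_filter, Finset.mem_univ, true_and, Finset.mem_insert,
      Nat.lt_succ_iff_lt_or_eq]
    constructor
    · rintro ⟨h1 | h1, h2⟩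
      · exact Or.inr ⟨h1, h2⟩
      · exact Or.inl (Fin.ext h1)
    · rintro (rfl | h1)
      · exact ⟨Or.inr rfl, h.symm⟩
      · exact ⟨Or.inl h1.1, h1.2⟩
  · rw [add_zero]
    congr 1
    ext i
    simp only [Finset.mem_filter, Finset.mem_univ, true_and, Nat.lt_succ_iff_lt_or_eq]
    constructor
    · rintro ⟨h1 | h1, h2⟩
      · exact ⟨h1, h2⟩
      · obtain rfl : i = ⟨n, hn⟩ := Fin.ext h1
        exact absurd h2.symm h
    · rintro ⟨h1, h2⟩
      exact ⟨Or.inl h1, h2⟩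

/-- By monotonicity no tally exceeds `u` before a band, so a bump never comes first. -/
theorem stopTime_eq_and_bandTime_eq_iff (l u : ℕ) (σ : Shuffle m s) (n : ℕ) :
    (stopTime l u σ = n ∧ bandTime l u σ = n) ↔ bandTime l u σ = n := by
  refine ⟨fun h => h.2, fun h => ⟨?_, h⟩⟩
  rw [stopTime, h, min_eq_left_iff]
  obtain ⟨⟨-, -, hband⟩, -⟩ := (sInf_natCast_eq_iff _ _).1 h
  apply le_sInf
  rintro _ ⟨k, rfl, -, -, hk⟩
  refine Nat.cast_le.2 (not_lt.1 fun hkn => ?_)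
  have : Finset.univ.sup (tally σ k) ≤ u :=
    Finset.sup_le fun j _ => (tally_mono σ j hkn.le).trans (hband j).2
  omega

/-- The band is completed at draw `n + 1` iff that draw lifts the last rank with a tally below `l`
to the tally `l`. -/
theorem bandTime_eq_succ_iff {l u : ℕ} (hl : 0 < l) (hlu : l ≤ u) (σ : Shuffle m s) {n : ℕ}
    (hn : n < m * s) (hln : m * l ≤ n + 1) :
    bandTime l u σ = (n + 1 : ℕ) ↔
      AlmostBand l u (σ ⟨n, hn⟩).1 ((draws m s n).map σ.toEmbedding) := by
  simp only [bandTime, sInf_natCast_eq_iff, AlmostBand, ← tally_eq_card_ofRank, Finset.mem_Icc]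
  constructor
  · rintro ⟨⟨-, -, h1⟩, h2⟩ i
    have hi := h1 i
    rw [tally_succ σ n hn] at hi
    split_ifs at hi ⊢ with h
    · by_contra hne
      -- Otherwise the rank drawn already had at least `l` cards, so the band was present at time
      -- `n`; summing tallies gives `m * l ≤ n`, contradicting minimality.
      have hall : ∀ j, l ≤ tally σ n j ∧ tally σ n j ≤ u := by
        intro j
        have hj := h1 j
        rw [tally_succ σ n hn] at hj
        split_ifs at hj with h'
        · rw [h', ← h]; omega
        · exact hj
      refine h2 n (Nat.lt_succ_self n) ⟨?_, hn.le, hall⟩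
      rw [← sum_tally σ hn.le]
      simpa using Finset.sum_le_sum fun j (_ : j ∈ Finset.univ) => (hall j).1
    · exact hi
  · intro h
    refine ⟨⟨hln, hn, fun j => ?_⟩, ?_⟩
    · have hj := h j
      rw [tally_succ σ n hn]
      split_ifs at hj ⊢ <;> omega
    · rintro k hk ⟨-, -, hall⟩
      have h1 := (hall (σ ⟨n, hn⟩).1).1
      have h2 := h (σ ⟨n, hn⟩).1
      rw [if_pos rfl] at h2
      have h3 := tally_mono σ (σ ⟨n, hn⟩).1 (Nat.lt_succ_iff.1 hk)
      omega

theorem prob_eq_div (A : Set (Shuffle m s)) [DecidablePred (· ∈ A)] :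
    prob A = ((Finset.univ.filter (· ∈ A)).card : ℝ) / (Fintype.card (Shuffle m s) : ℝ) := by
  classical
  rw [prob, PMF.toOuterMeasure_uniformOfFintype_apply, ENNReal.toReal_div, ENNReal.toReal_natCast,
    ENNReal.toReal_natCast, ← Fintype.card_subtype]

theorem bandProb_succ {l u : ℕ} (hl : 0 < l) (hlu : l ≤ u) {n : ℕ}
    (hn : n < m * s) (hln : m * l ≤ n + 1) (hln' : l - 1 ≤ n) :
    bandProb m s l u (n + 1) = (s - 1).choose (l - 1) *
      ((truncBinomial s l u ^ (m - 1)).coeff (n - (l - 1)) / (m * s - 1).choose n) := by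
  classical
  obtain ⟨K, hK⟩ := exists_card_equiv_eq_mul (β := Fin m × Fin s) (⟨n, hn⟩ : Fin (m * s))
    (draws m s n) (by simp [draws])
  have htot := hK fun _ _ => True
  have hband := hK fun c S => AlmostBand l u c.1 S
  simp only [Finset.filter_true, Finset.card_univ, Finset.card_powersetCard,
    Finset.card_erase_of_mem (Finset.mem_univ _), Finset.sum_const, Fintype.card_prod,
    Fintype.card_fin, card_draws hn.le, smul_eq_mul] at htot
  have hsum : ((∑ c : Fin m × Fin s, (((Finset.univ.erase c).powersetCard (draws m s n).card).filter
      (AlmostBand l u c.1)).card : ℕ) : ℝ) = (m * s : ℕ) * ((s - 1).choose (l - 1) *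
        (truncBinomial s l u ^ (m - 1)).coeff (n - (l - 1))) := by
    push_cast
    rw [card_draws hn.le, Finset.sum_congr rfl fun c _ => card_almostBand l u n c hln']
    simp
  rw [bandProb, prob_eq_div]
  simp only [Set.mem_ofPred_eq, stopTime_eq_and_bandTime_eq_iff]
  simp only [bandTime_eq_succ_iff hl hlu _ hn hln]
  rw [hband, htot, Nat.cast_mul, hsum]
  -- The total count is `K` times the number of pairs, and shuffles exist.
  have hK0 : (K : ℝ) ≠ 0 := by
    rintro h0
    rw [Nat.cast_eq_zero.1 h0, mul_zero] at htot
    exact Fintype.card_ne_zero htot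
  have h1 : ((m * s : ℕ) : ℝ) ≠ 0 := Nat.cast_ne_zero.2 (by omega)
  have h2 : ((m * s - 1).choose n : ℝ) ≠ 0 := Nat.cast_ne_zero.2 (Nat.choose_pos (by omega)).ne'
  rw [Nat.cast_mul _ K, Nat.cast_mul (m * s) ((m * s - 1).choose n)]
  generalize ((m * s : ℕ) : ℝ) = t at h1 ⊢
  field_simp

/-! ### Closed form of the band probabilities and its consequences -/

theorem rectProb_const_eq (r k s l u : ℕ) :
    rectProb (fun _ : Fin r => s) k (fun _ => l) (fun _ => u) =
      (truncBinomial s l u ^ r).coeff k / (r * s).choose k := by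
  have h : truncBinomial s l u ^ r = ∏ _j : Fin r, truncBinomial s l u := by simp
  rw [h]
  simp only [truncBinomial]
  rw [Finset.prod_univ_sum, Polynomial.finsetSum_coeff, Finset.sum_div, rectProb]
  refine Finset.sum_congr rfl fun x _ => ?_
  simp only [← Polynomial.C_mul_X_pow_eq_monomial]
  rw [Finset.prod_mul_distrib, Finset.prod_pow_eq_pow_sum, ← map_prod, Polynomial.coeff_C_mul_X_pow,
    multiHypergeom]
  simp only [Finset.sum_const, Finset.card_univ, Fintype.card_fin, smul_eq_mul, eq_comm (a := k)]
  split_ifs <;> simp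

theorem bandProb_eq {m s l u : ℕ} (hm : 0 < m) (hl : 0 < l) (hlu : l ≤ u) (hus : u ≤ s) {n : ℕ}
    (h1 : m * l ≤ n) (h2 : n ≤ l + (m - 1) * u) :
    bandProb m s l u n = (s - 1).choose (l - 1) *
      ((truncBinomial s l u ^ (m - 1)).coeff (n - l) /
        ((m - 1) * s + s - 1).choose (n - 1)) := by
  obtain ⟨r, rfl⟩ : ∃ r, m = r + 1 := ⟨m - 1, by omega⟩
  rw [Nat.add_sub_cancel] at *
  rw [Nat.add_mul, one_mul] at h1
  have h3 : r * u ≤ r * s := Nat.mul_le_mul_left r hus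
  have h4 : (r + 1) * s = r * s + s := by ring
  have h5 : (r + 1) * l = r * l + l := by ring
  obtain ⟨k, rfl⟩ : ∃ k, n = k + 1 := ⟨n - 1, by omega⟩
  rw [bandProb_succ hl hlu (by omega) (by omega) (by omega), h4, Nat.add_sub_cancel,
    Nat.add_sub_cancel, show k - (l - 1) = k + 1 - l by omega]

theorem bandProb_pos {m s l u : ℕ} (hm : 0 < m) (hl : 0 < l) (hlu : l ≤ u) (hus : u ≤ s) {n : ℕ}
    (h1 : m * l ≤ n) (h2 : n ≤ l + (m - 1) * u) : 0 < bandProb m s l u n := by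
  rw [bandProb_eq hm hl hlu hus h1 h2]
  obtain ⟨r, rfl⟩ : ∃ r, m = r + 1 := ⟨m - 1, by omega⟩
  rw [Nat.add_sub_cancel] at *
  rw [Nat.add_mul, one_mul] at h1
  have h3 : r * u ≤ r * s := Nat.mul_le_mul_left r hus
  exact mul_pos (Nat.cast_pos.2 (Nat.choose_pos (by omega)))
    (div_pos (truncBinomial_pow_coeff_pos hlu hus _ _ (by omega) (by omega))
      (Nat.cast_pos.2 (Nat.choose_pos (by omega))))

theorem bandProb_logConcave {m s l u : ℕ} (hm : 0 < m) (hl : 0 < l) (hlu : l ≤ u) (hus : u ≤ s)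
    {n : ℕ} (h1 : m * l < n) (h2 : n < l + (m - 1) * u) :
    bandProb m s l u (n + 1) * bandProb m s l u (n - 1) ≤ bandProb m s l u n ^ 2 := by
  rw [bandProb_eq hm hl hlu hus (n := n + 1) (by omega) (by omega),
    bandProb_eq hm hl hlu hus (n := n - 1) (by omega) (by omega),
    bandProb_eq hm hl hlu hus (n := n) (by omega) (by omega)]
  obtain ⟨r, rfl⟩ : ∃ r, m = r + 1 := ⟨m - 1, by omega⟩
  rw [Nat.add_sub_cancel] at *
  rw [Nat.add_mul, one_mul] at h1
  have h3 : r * u ≤ r * s := Nat.mul_le_mul_left r hus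
  obtain ⟨k, rfl⟩ : ∃ k, n = k + l + 1 := ⟨n - l - 1, by omega⟩
  have key := mul_le_mul_of_nonneg_left
    (truncBinomial_div_choose_logConcave (u := u) hl (hlu.trans hus) r k (by omega))
    (sq_nonneg ((s - 1).choose (l - 1) : ℝ))
  rw [show k + l + 1 + 1 - l = k + 2 by omega, show k + l + 1 - 1 - l = k by omega,
    show k + l + 1 - l = k + 1 by omega, show k + l + 1 + 1 - 1 = k + l + 1 by omega,
    show k + l + 1 - 1 - 1 = k + l - 1 by omega, show k + l + 1 - 1 = k + l by omega]
  rw [mul_pow]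
  refine le_trans (le_of_eq ?_) key
  ring

/-- The numerator `C((m-1)s, n-l)` of the first law cancels the denominator of the second. -/
theorem bandProb_eq_mul {m s l u : ℕ} (hm : 0 < m) (hl : 0 < l) (hlu : l ≤ u) (hus : u ≤ s)
    {n : ℕ} (h1 : m * l ≤ n) (h2 : n ≤ l + (m - 1) * u) :
    bandProb m s l u n = multiHypergeom ![s - 1, m * s - s] (n - 1) ![l - 1, n - l] *
      rectProb (fun _ : Fin (m - 1) => s) (n - l) (fun _ => l) (fun _ => u) := by
  rw [bandProb_eq hm hl hlu hus h1 h2, rectProb_const_eq]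
  obtain ⟨r, rfl⟩ : ∃ r, m = r + 1 := ⟨m - 1, by omega⟩
  rw [Nat.add_sub_cancel] at *
  rw [Nat.add_mul, one_mul] at h1
  have h3 : r * u ≤ r * s := Nat.mul_le_mul_left r hus
  have hC : ((r * s).choose (n - l) : ℝ) ≠ 0 :=
    Nat.cast_ne_zero.2 (Nat.choose_pos (by omega)).ne'
  rw [multiHypergeom, show (r + 1) * s - s = r * s by rw [Nat.add_mul, one_mul]; omega]
  simp only [Fin.sum_univ_two, Fin.prod_univ_two, Matrix.cons_val_zero, Matrix.cons_val_one]
  rw [if_pos (by omega), show s - 1 + r * s = r * s + s - 1 by omega]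
  field_simp

end BandBump

theorem mainTheorem4 (m s l u : ℕ) (hm : 0 < m) (hl : 0 < l) (hlu : l ≤ u) (hus : u ≤ s) :
    (∀ n : ℕ, m * l ≤ n → n ≤ l + (m - 1) * u →
      BandBump.bandProb m s l u n =
        BandBump.multiHypergeom ![s - 1, m * s - s] (n - 1) ![l - 1, n - l] *
          BandBump.rectProb (fun _ : Fin (m - 1) => s) (n - l) (fun _ => l) (fun _ => u)) ∧
    BandBump.LogConcaveBetween (BandBump.bandProb m s l u) (m * l) (l + (m - 1) * u) := by
  refine ⟨fun n h1 h2 => BandBump.bandProb_eq_mul hm hl hlu hus h1 h2,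
    fun n h1 h2 => (BandBump.bandProb_pos hm hl hlu hus h1 h2).le,
    fun n h1 h2 => BandBump.bandProb_logConcave hm hl hlu hus h1 h2, ?_⟩
  refine ⟨fun a ha b hb n hn => ?_⟩
  have h1 := ha.1.trans hn.1
  have h2 := hn.2.trans hb.2.1
  exact ⟨h1, h2, BandBump.bandProb_pos hm hl hlu hus h1 h2⟩
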